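/- Consider a stable matching instance with finite sets $M$ of men and $W$ of women, $|M|=|W|$, in which every agent has a strict total order (the true preference list) over all agents of the other side; let $P$ be this profile. Let $L\subseteq W$ be the set of manipulators. A permutation manipulation replaces the list of each woman in $L$ by an arbitrary strict total order on $M$ and keeps all other lists; it is feasible if the matching that the men-proposing Gale–Shapley algorithm produces from the reported lists (the induced matching) is stable with respect to $P$. Let $S_A$ be the set of all matchings induced by feasible permutation manipulations. Run Gale–Shapley on $P$ and let every woman delete all men ranked below her final proposer (deleting also herself from their lists, together with all rejected pairs); this gives the reduced table of $P$. A rotation exposed in a reduced table is a cyclic sequence (up to cyclic shift) of distinct pairs $(m_1,w_1),\dots,(m_r,w_r)$ such that, for every $i$ modulo $r$, $w_i$ is the first and $w_{i+1}$ the second woman in the reduced list of $m_i$. To eliminate it, let each $m_i$ propose to $w_{i+1}$, who deletes all men whom she ranks below $m_i$. The rotations of $P$ are those exposed in some table obtained from the reduced table of $P$ by successively eliminating exposed rotations. For rotations $R_1,R_2$ write $R_1\prec R_2$ if $R_2$ can only be exposed after $R_1$ has been eliminated, i.e. $R_1$ has been eliminated in every such succession of eliminations that leads to a table in which $R_2$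 is exposed. A set $\mathcal R$ of rotations is closed if $R\in\mathcal R$ and $R'\prec R$ imply $R'\in\mathcal R$, and $CloSet(R)$ is the smallest closed set that contains $R$. A closed set $\mathcal R$ can be eliminated if the matching obtained by successively eliminating exactly the rotations of $\mathcal R$, in which every man is matched to the first woman of his list in the final table, belongs to $S_A$. Theorem. Let $\mathcal R$ be a nonempty closed set of rotations that can be eliminated. Then there is a rotation $R\in\mathcal R$ such that $CloSet(R)$ can be eliminated. -/

import Mathlib

namespace StableMarriage

/-- A profile of complete strict preference lists: `P.men m w w'` means that the man `m` strictly
prefers the woman `w` to the woman `w'`, and `P.women w m m'` that the woman `w` strictly prefers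
the man `m` to the man `m'`. -/
structure Profile (M W : Type*) where
  men : M → W → W → Prop
  women : W → M → M → Prop
  men_order : ∀ m, IsStrictTotalOrder W (men m)
  women_order : ∀ w, IsStrictTotalOrder M (women w)

variable {M W : Type*}

/-- No man and woman prefer each other to their partners. Lists are complete and there are as many
men as women, so matchings are bijections and individual rationality is automatic. -/
def IsStable (P : Profile M W) (μ : M ≃ W) : Prop :=
  ∀ m w, ¬ (P.men m w (μ m) ∧ P.women w m (μ.symm w))

/-- A table is the set of the pairs `(m, w)` that have not been deleted from the lists of `m` and
of `w`. `IsFirst P T m w`: the woman `w` is the first one left in the list of `m`. -/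
def IsFirst (P : Profile M W) (T : Set (M × W)) (m : M) (w : W) : Prop :=
  (m, w) ∈ T ∧ ∀ w', (m, w') ∈ T → w' ≠ w → P.men m w w'

/-- The woman `w` is the second one left in the list of `m`. -/
def IsSecond (P : Profile M W) (T : Set (M × W)) (m : M) (w : W) : Prop :=
  ∃ w₁, IsFirst P T m w₁ ∧ IsFirst P (T \ {(m, w₁)}) m w

/-- One round of the men-proposing Gale-Shapley algorithm: every man proposes to the first woman
who has not rejected him yet, and every woman rejects all her proposers but the best one. -/
def proposalRound (P : Profile M W) (T : Set (M × W)) : Set (M × W) :=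
  {p ∈ T | ¬ (IsFirst P T p.1 p.2 ∧ ∃ m, IsFirst P T m p.2 ∧ P.women p.2 m p.1)}

/-- The pairs `(m, w)` such that `w` never rejects `m` in the Gale-Shapley algorithm. -/
def galeShapley (P : Profile M W) : Set (M × W) :=
  ⋂ k : ℕ, (proposalRound P)^[k] Set.univ

/-- `μ` is the matching produced by the Gale-Shapley algorithm. -/
def IsInduced (P : Profile M W) (μ : M ≃ W) : Prop :=
  ∀ m, IsFirst P (galeShapley P) m (μ m)

/-- The profile `P'` arises from the true profile `P` by a permutation manipulation of the women
in `L`: they report arbitrary strict total orders on the set of all men, and nobody else lies. -/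
def IsPermutationManipulation (P : Profile M W) (L : Set W) (P' : Profile M W) : Prop :=
  P'.men = P.men ∧ ∀ w, w ∉ L → P'.women w = P.women w

/-- The matchings that are induced by a feasible permutation manipulation, one whose outcome is
stable with respect to the true profile `P`. -/
def feasibleMatchings (P : Profile M W) (L : Set W) : Set (M ≃ W) :=
  {μ | IsStable P μ ∧ ∃ P', IsPermutationManipulation P L P' ∧ IsInduced P' μ}

/-- The reduced table at the end of the Gale-Shapley algorithm: every woman also deletes all the
men that she ranks below her current proposer. -/
def reducedTable (P : Profile M W) : Set (M × W) :=
  {p ∈ galeShapley P | ∀ m, IsFirst P (galeShapley P) m p.2 → ¬ P.women p.2 m p.1}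

/-- A rotation is the cyclic sequence of its pairs `(mᵢ, wᵢ)`, up to cyclic shifts. It is exposed
in the table `T` if `wᵢ` is the first and `wᵢ₊₁` the second woman in the list of `mᵢ` in `T`, for
all `i` (cyclically). -/
def IsExposed (P : Profile M W) (T : Set (M × W)) (R : Cycle (M × W)) : Prop :=
  R ≠ Cycle.nil ∧ R.Nodup ∧
    R.Chain fun p q => IsFirst P T p.1 p.2 ∧ IsFirst P T q.1 q.2 ∧ IsSecond P T p.1 q.2

/-- The table after eliminating the rotation `R` exposed in `T`: every man of `R` proposes to the
second woman in his list, and she deletes all the men that she ranks below him, her previous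
partner among them. -/
def eliminate (P : Profile M W) (T : Set (M × W)) (R : Cycle (M × W)) : Set (M × W) :=
  {p ∈ T | ∀ q ∈ R, IsSecond P T q.1 p.2 → ¬ P.women p.2 q.1 p.1}

/-- `EliminatesTo P 𝓢 T`: starting from the reduced table of `P`, one can eliminate exactly the
rotations in `𝓢`, one after another in some order, each being exposed when its turn comes, and
this ends with the table `T`. -/
inductive EliminatesTo (P : Profile M W) : Set (Cycle (M × W)) → Set (M × W) → Prop
  | start : EliminatesTo P ∅ (reducedTable P)
  | step {𝓢 : Set (Cycle (M × W))} {T : Set (M × W)} {R : Cycle (M × W)} :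
      EliminatesTo P 𝓢 T → IsExposed P T R → EliminatesTo P (insert R 𝓢) (eliminate P T R)

/-- The rotations of `P`: those that are exposed at some stage. -/
def IsRotation (P : Profile M W) (R : Cycle (M × W)) : Prop :=
  ∃ 𝓢 T, EliminatesTo P 𝓢 T ∧ IsExposed P T R

/-- `R₁ ≺ R₂`: the rotation `R₂` can only be exposed after `R₁` has been eliminated. -/
def Precedes (P : Profile M W) (R₁ R₂ : Cycle (M × W)) : Prop :=
  IsRotation P R₁ ∧ IsRotation P R₂ ∧
    ∀ 𝓢 T, EliminatesTo P 𝓢 T → IsExposed P T R₂ → R₁ ∈ 𝓢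

/-- Sets of rotations that contain all predecessors of their members. -/
def IsClosedSet (P : Profile M W) (𝓡 : Set (Cycle (M × W))) : Prop :=
  (∀ R ∈ 𝓡, IsRotation P R) ∧ ∀ R ∈ 𝓡, ∀ R', Precedes P R' R → R' ∈ 𝓡

/-- The smallest closed set of rotations that contains `𝓢`. -/
def CloSet (P : Profile M W) (𝓢 : Set (Cycle (M × W))) : Set (Cycle (M × W)) :=
  ⋂₀ {𝓒 | IsClosedSet P 𝓒 ∧ 𝓢 ⊆ 𝓒}

/-- The set `𝓡` of rotations can be eliminated by the manipulators in `L`: the matching obtained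
by eliminating `𝓡`, in which every man has the first woman of his list in the final table, is
induced by a feasible permutation manipulation. -/
def CanBeEliminated (P : Profile M W) (L : Set W) (𝓡 : Set (Cycle (M × W))) : Prop :=
  ∃ (T : Set (M × W)) (μ : M ≃ W),
    EliminatesTo P 𝓡 T ∧ (∀ m, IsFirst P T m (μ m)) ∧ μ ∈ feasibleMatchings P L

end StableMarriage

/-! Fix a stable matching `ν`. A woman's suitors are the men who prefer her to their partners; if
she is no manipulator, only her favourite among them counts. Draw an edge from `w` to the partner `ν
s` of each such suitor `s`. Then `ν` can be induced by a feasible manipulation iff from every woman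
a path leads to a woman without suitors: `exists_escapes_of_mem_feasibleMatchings` and
`mem_feasibleMatchings_of_escapes`.

The rotations that can have been eliminated last before `ν` are those exposed at `ν` with the sexes
exchanged. If some woman cannot escape, following favourite suitors never leaves the set of trapped
women and closes up into such a last rotation, all of whose women are trapped. So when there is only
one last rotation, a single escaping woman on it shows that all women escape.

When there are several, cut an escape at its last visit to a woman on a last rotation `τ`, and undo
another last rotation `τ'`. This moves no partner used by the rest of the path, favourite suitors on
it stay favourite, and `τ` remains a last rotation. Each undoing improves the men, so the process
ends with one last rotation (`exists_unique_last`). A matching with a unique last rotation `R` is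
exactly the one reached by eliminating the closure of `R` (`exists_eliminatesTo_cloSet`). -/

namespace StableMarriage

open Function Equiv

/-! ### Stable matchings by ranks, and rotations as permutations -/

section

variable {M W : Type*}

/-- Stability of `μ` when the man `m` ranks the woman `w` at place `a m w` and she ranks him at
place `b w m`; smaller is better. -/
def RankStable (a : M → W → ℕ) (b : W → M → ℕ) (μ : M ≃ W) : Prop :=
  ∀ m w, a m w < a m (μ m) → b w (μ.symm w) ≤ b w m

/-- `μ m'` is the best woman for `m` among those below `μ m` who prefer `m` to their partners. -/
def IsNext (a : M → W → ℕ) (b : W → M → ℕ) (μ : M ≃ W) (m m' : M) : Prop :=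
  (a m (μ m) < a m (μ m') ∧ b (μ m') m < b (μ m') m') ∧
    ∀ w, a m (μ m) < a m w → b w m < b w (μ.symm w) → a m (μ m') ≤ a m w

/-- A permutation of the men that describes a rotation exposed at `μ`. -/
def IsRot (a : M → W → ℕ) (b : W → M → ℕ) (μ : M ≃ W) (σ : Perm M) : Prop :=
  σ.IsCycle ∧ ∀ m, σ m ≠ m → IsNext a b μ m (σ m)

variable {a : M → W → ℕ} {b : W → M → ℕ} {μ ν : M ≃ W} {σ τ : Perm M}

theorem RankStable.swap (h : RankStable a b μ) :
    RankStable b a μ.symm := by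
  intro w m hlt
  by_contra! hc
  simp only [Equiv.symm_symm] at hc
  exact absurd (h m w hc) (by omega)

/-- A man who prefers `ν` leaves a woman who prefers `μ`. -/
theorem RankStable.lt_of_lt [Finite M] (ha : ∀ m, Injective (a m)) (hb : ∀ w, Injective (b w))
    (hμ : RankStable a b μ) (hν : RankStable a b ν) {m : M} (h : a m (ν m) < a m (μ m)) :
    b (μ m) m < b (μ m) (ν.symm (μ m)) := by
  set S : Set M := {m | a m (ν m) < a m (μ m)} with hS
  have key : ∀ x ∈ S, b (ν x) (μ.symm (ν x)) < b (ν x) x := by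
    intro x hx
    refine lt_of_le_of_ne (hμ x _ hx) fun he => ?_
    have := hb _ he
    rw [Equiv.symm_apply_eq] at this
    simp only [hS, Set.mem_ofPred_eq, this, lt_irrefl] at hx
  have hsub : (fun x => μ.symm (ν x)) '' S ⊆ S := by
    rintro _ ⟨x, hx, rfl⟩
    have h1 := key x hx
    simp only [hS, Set.mem_ofPred_eq, Equiv.apply_symm_apply]
    by_contra! hc
    rcases hc.lt_or_eq with hc | hc
    · have := hν _ _ hc
      simp only [Equiv.symm_apply_apply] at this
      omega
    · have := ν.injective (ha _ hc)
      rw [← this] at h1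
      exact lt_irrefl _ h1
  have hinj : Injective fun x => μ.symm (ν x) := μ.symm.injective.comp ν.injective
  -- An injection of the finite set `S` into itself is onto, so `μ m` is the `ν`-partner of some man
  -- in `S`, and `key` applies to him.
  have heq := Set.eq_of_subset_of_ncard_le hsub (Set.ncard_image_of_injective S hinj).ge
    (Set.toFinite _)
  obtain ⟨x, hx, hxm⟩ : m ∈ (fun x => μ.symm (ν x)) '' S := by rw [heq]; exact h
  have hxm' : μ m = ν x := by rw [← hxm]; simp
  have h1 := key x hx
  rw [← hxm', Equiv.symm_apply_apply] at h1
  rw [hxm', Equiv.symm_apply_apply, ← hxm']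
  exact h1

theorem RankStable.symm_le_of_le (hν : RankStable a b ν) (ha : ∀ m, Injective (a m))
    (h : ∀ m, a m (μ m) ≤ a m (ν m)) (w : W) : b w (ν.symm w) ≤ b w (μ.symm w) := by
  have h1 := h (μ.symm w)
  rw [Equiv.apply_symm_apply] at h1
  rcases h1.lt_or_eq with h1 | h1
  · exact hν _ _ h1
  · have := ha _ h1
    rw [← (Equiv.symm_apply_eq ν).2 this]

theorem IsNext.ne {m m' : M} (h : IsNext a b μ m m') : m ≠ m' := by
  rintro rfl
  exact lt_irrefl _ h.1.1

theorem IsNext.unique (ha : ∀ m, Injective (a m)) {m m₁ m₂ : M} (h₁ : IsNext a b μ m m₁)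
    (h₂ : IsNext a b μ m m₂) : m₁ = m₂ := by
  refine μ.injective (ha m (le_antisymm (h₁.2 _ h₂.1.1 ?_) (h₂.2 _ h₁.1.1 ?_)))
  · simpa using h₂.1.2
  · simpa using h₁.1.2

theorem exists_isNext {m : M} {w : W} (h₁ : a m (μ m) < a m w)
    (h₂ : b w m < b w (μ.symm w)) : ∃ m', IsNext a b μ m m' := by
  let S : Set W := {w | a m (μ m) < a m w ∧ b w m < b w (μ.symm w)}
  obtain ⟨v, hv, hmin⟩ := (InvImage.wf (a m) wellFounded_lt).has_min S ⟨w, h₁, h₂⟩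
  refine ⟨μ.symm v, ?_, fun u hu₁ hu₂ => ?_⟩
  · simpa using show a m (μ m) < a m v ∧ b v m < b v (μ.symm v) from hv
  · simpa using not_lt.1 (show ¬ a m u < a m v from hmin u ⟨hu₁, hu₂⟩)

section Finite
variable [Finite M]

theorem IsNext.le (ha : ∀ m, Injective (a m)) (hb : ∀ w, Injective (b w))
    (hν : RankStable a b ν) (hμ : RankStable a b μ) {m m' : M} (h : IsNext a b ν m m')
    (hlt : a m (ν m) < a m (μ m)) : a m (ν m') ≤ a m (μ m) :=
  h.2 _ hlt (hμ.lt_of_lt ha hb hν hlt)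

/-- In `μ` the woman `ν m'` holds a man at least as good for her as `m`, so she gains; by
`RankStable.lt_of_lt` for the women, her partner `m'` loses. Hence the men who are worse off in `μ`
are closed under successors. -/
theorem IsNext.lt (ha : ∀ m, Injective (a m)) (hb : ∀ w, Injective (b w))
    (hν : RankStable a b ν) (hμ : RankStable a b μ) {m m' : M} (h : IsNext a b ν m m')
    (hlt : a m (ν m) < a m (μ m)) : a m' (ν m') < a m' (μ m') := by
  have := Finite.of_equiv M ν
  have h1 : b (ν m') (μ.symm (ν m')) < b (ν m') m' := by
    rcases (h.le ha hb hν hμ hlt).lt_or_eq with h1 | h1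
    · exact (hμ _ _ h1).trans_lt h.1.2
    · rw [ha _ h1, Equiv.symm_apply_apply, ← ha _ h1]
      exact h.1.2
  have := (hν.swap).lt_of_lt hb ha (hμ.swap) (m := ν m') (by simpa using h1)
  simpa using this

/-- A choice of successors is a self-map of `B`, bijective on its periodic points. Extended by the
identity it is a permutation, and any of its nontrivial cycles will do. -/
theorem exists_isCycle {α : Type*} [Finite α] {r : α → α → Prop} (hr : ∀ x, ¬ r x x) {B : Set α}
    (hB : B.Nonempty) (h : ∀ x ∈ B, ∃ y ∈ B, r x y) :
    ∃ σ : Perm α, σ.IsCycle ∧ ∀ x, σ x ≠ x → x ∈ B ∧ r x (σ x) := by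
  classical
  choose! f hfB hf using h
  obtain ⟨x₀, hx₀⟩ := hB
  let g : B → B := fun x => ⟨f x, hfB x x.2⟩
  have hbij := bijOn_periodicPts (f := g)
  obtain ⟨m, n, hne, hmn⟩ := Finite.exists_ne_map_eq_of_infinite fun n : ℕ => g^[n] ⟨x₀, hx₀⟩
  obtain ⟨y, hy⟩ : ∃ y, y ∈ periodicPts g := by
    wlog hlt : m < n generalizing m n
    · exact this n m hne.symm hmn.symm (by omega)
    · refine ⟨g^[m] ⟨x₀, hx₀⟩, mk_mem_periodicPts (n := n - m) (by omega) ?_⟩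
      rw [IsPeriodicPt, IsFixedPt, ← iterate_add_apply, Nat.sub_add_cancel hlt.le]
      exact hmn.symm
  let e : Perm (periodicPts g) := hbij.equiv g
  let ρ : Perm α := (e.ofSubtype).ofSubtype
  have hρ : ∀ x, ρ x ≠ x → x ∈ B ∧ ρ x = f x := by
    intro x hx
    by_cases hxB : x ∈ B
    · refine ⟨hxB, ?_⟩
      by_cases hxp : (⟨x, hxB⟩ : B) ∈ periodicPts g
      · simp only [ρ]
        rw [Perm.ofSubtype_apply_of_mem _ hxB, Perm.ofSubtype_apply_of_mem _ hxp]
        rfl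
      · refine absurd ?_ hx
        simp only [ρ]
        rw [Perm.ofSubtype_apply_of_mem _ hxB, Perm.ofSubtype_apply_of_not_mem _ hxp]
    · exact absurd (Perm.ofSubtype_apply_of_not_mem _ hxB) hx
  have hρy : ρ y ≠ y := by
    have : ρ y = f y := by
      simp only [ρ]
      rw [Perm.ofSubtype_apply_of_mem _ y.2, Perm.ofSubtype_apply_of_mem _ hy]
      rfl
    rw [this]
    intro he
    exact hr y (by simpa [he] using hf y y.2)
  refine ⟨ρ.cycleOf y, Perm.isCycle_cycleOf _ hρy, fun x hx => ?_⟩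
  rw [Perm.cycleOf_apply] at hx ⊢
  split_ifs at hx ⊢ with hs
  · obtain ⟨h1, h2⟩ := hρ x hx
    exact ⟨h1, h2 ▸ hf x h1⟩
  · exact absurd rfl hx

theorem exists_isRot_of_closed {B : Set M} (hB : B.Nonempty)
    (h : ∀ x ∈ B, ∃ y ∈ B, IsNext a b ν x y) : ∃ σ, IsRot a b ν σ ∧ ∀ m, σ m ≠ m → m ∈ B := by
  obtain ⟨σ, hσ, h⟩ := exists_isCycle (fun x hx => hx.ne rfl) hB h
  exact ⟨σ, ⟨hσ, fun m hm => (h m hm).2⟩, fun m hm => (h m hm).1⟩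

/-- If some man is worse off in `μ`, then a rotation all of whose men are worse off in `μ` is
exposed at `ν`. -/
theorem exists_isRot (ha : ∀ m, Injective (a m)) (hb : ∀ w, Injective (b w))
    (hν : RankStable a b ν) (hμ : RankStable a b μ) (h : ∃ m, a m (ν m) < a m (μ m)) :
    ∃ σ, IsRot a b ν σ ∧ ∀ m, σ m ≠ m → a m (ν m) < a m (μ m) := by
  refine exists_isRot_of_closed (B := {m | a m (ν m) < a m (μ m)}) h fun m hm => ?_
  obtain ⟨m', hm'⟩ := exists_isNext hm (hμ.lt_of_lt ha hb hν hm)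
  exact ⟨m', hm'.lt ha hb hν hμ hm, hm'⟩

end Finite

theorem IsRot.le_trans (hσ : IsRot a b ν σ) (m : M) : a m (ν m) ≤ a m (σ.trans ν m) := by
  by_cases h : σ m = m
  · simp [h]
  · exact (hσ.2 m h).1.1.le

theorem IsRot.symm_trans_le (hσ : IsRot a b ν σ) (w : W) :
    b w ((σ.trans ν).symm w) ≤ b w (ν.symm w) := by
  simp only [Equiv.symm_trans_apply]
  by_cases h : σ (σ.symm (ν.symm w)) = σ.symm (ν.symm w)
  · rw [← h]; simp
  · simpa using (hσ.2 _ h).1.2.le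

theorem IsRot.rankStable (hσ : IsRot a b ν σ) (hν : RankStable a b ν)
    (ha : ∀ m, Injective (a m)) : RankStable a b (σ.trans ν) := by
  intro m w h
  have h1 := hσ.symm_trans_le w
  rcases lt_trichotomy (a m w) (a m (ν m)) with h2 | h2 | h2
  · exact h1.trans (hν _ _ h2)
  · have := ha _ h2
    subst this
    simpa using h1
  · refine h1.trans ?_
    by_contra! h3
    have hm : σ m ≠ m := by
      intro he
      simp only [Equiv.trans_apply, he] at h
      omega
    exact absurd ((hσ.2 m hm).2 w h2 h3) (by simpa using h)

/-- After its elimination a rotation is exposed on the side of the women, and eliminating it there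
restores the former matching. -/
theorem IsRot.dual (hσ : IsRot a b ν σ) (hν : RankStable a b ν)
    (ha : ∀ m, Injective (a m)) :     IsRot b a (σ.trans ν).symm (ν.permCongr σ) := by
  have hperm : ν.permCongr σ = ν.symm.trans (σ.trans ν) := rfl
  refine ⟨?_, fun w hw => ?_⟩
  · obtain ⟨x, hx, h⟩ := hσ.1
    refine ⟨ν x, by simpa [hperm] using hx, fun w hw => ?_⟩
    obtain ⟨i, hi⟩ := h (y := ν.symm w) (by
      intro he
      apply hw
      simp [hperm, he])
    refine ⟨i, ?_⟩
    have : (ν.permCongr σ) ^ i = ν.permCongr (σ ^ i) := (map_zpow ν.permCongrHom σ i).symm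
    rw [this, Equiv.permCongr_apply, Equiv.symm_apply_apply, hi, Equiv.apply_symm_apply]
  · obtain ⟨y, rfl⟩ := (σ.trans ν).surjective w
    have hy : σ y ≠ y := by
      intro he
      apply hw
      simp [hperm, he]
    have hy' : σ (σ y) ≠ σ y := by simpa using hy
    have h₁ := hσ.2 y hy
    have h₂ := hσ.2 (σ y) hy'
    simp only [IsNext, hperm, Equiv.symm_apply_apply, Equiv.symm_trans_apply, Equiv.trans_apply,
      Equiv.symm_symm]
    refine ⟨⟨h₁.1.2, h₂.1.1⟩, fun m hm hm' => ?_⟩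
    -- Suppose the woman prefers `m` to her old partner `σ y`. By stability of `ν`, `m` did not
    -- prefer her to `ν m`, so she was a candidate for his next woman. Then he has not moved past
    -- her, contrary to `hm'`.
    by_contra! hc
    have hle : a m (ν m) ≤ a m (ν (σ y)) := by
      by_contra! h3
      have := hν _ _ h3
      rw [Equiv.symm_apply_apply] at this
      omega
    rcases hle.lt_or_eq with h3 | h3
    · have hs : σ m ≠ m := by
        intro he
        rw [he] at hm'
        omega
      have := (hσ.2 m hs).2 _ h3 (by simpa using hc)
      omega
    · rw [ν.injective (ha _ h3)] at hc
      exact lt_irrefl _ hc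

theorem permCongr_trans_symm : (ν.permCongr σ).trans (σ.trans ν).symm = ν.symm := by
  ext w
  simp [Equiv.permCongr_apply]

theorem IsRot.eq_of_not_disjoint [Finite M] (ha : ∀ m, Injective (a m)) (hσ : IsRot a b ν σ)
    (hτ : IsRot a b ν τ) {m : M} (h₁ : σ m ≠ m) (h₂ : τ m ≠ m) : σ = τ := by
  classical
  cases nonempty_fintype M
  have key : ∀ x, σ x ≠ x → τ x ≠ x → σ x = τ x := fun x hx hx' =>
    (hσ.2 x hx).unique ha (hτ.2 x hx')
  refine hσ.1.eq_on_support_inter_nonempty_congr hτ.1 (x := m) ?_ (key m h₁ h₂) (by simpa using h₁)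
  intro x hx
  simp only [Finset.mem_inter, Perm.mem_support] at hx
  exact key x hx.1 hx.2

/-- Distinct rotations exposed at `ν` are disjoint, so `τ` leaves the partners along `σ` alone;
elsewhere women only become more demanding, so no new candidate appears. -/
theorem IsRot.persist [Finite M] (ha : ∀ m, Injective (a m)) (hσ : IsRot a b ν σ)
    (hτ : IsRot a b ν τ) (hne : σ ≠ τ) : IsRot a b (τ.trans ν) σ := by
  have key : ∀ m, σ m ≠ m → τ m = m := fun m hm => by
    by_contra hc
    exact hne (hσ.eq_of_not_disjoint ha hτ hm hc)
  refine ⟨hσ.1, fun m hm => ?_⟩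
  have h1 := key m hm
  have h2 := key (σ m) (by simpa using hm)
  obtain ⟨h3, h4⟩ := hσ.2 m hm
  simp only [IsNext, Equiv.trans_apply, h1, h2]
  exact ⟨h3, fun w hw hw' => h4 w hw (hw'.trans_le (hτ.symm_trans_le w))⟩

end

/-! ### The Gale–Shapley algorithm and its reduced table -/

section

variable {M W : Type*} {a : M → W → ℕ} {b : W → M → ℕ} {μ ν : M ≃ W} {P : Profile M W}

/-- The preference lists of `P` are those given by the injective rank functions `a` and `b`. -/
structure IsRanking (P : Profile M W) (a : M → W → ℕ) (b : W → M → ℕ) : Prop where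
  men_injective : ∀ m, Injective (a m)
  women_injective : ∀ w, Injective (b w)
  men_iff : ∀ m w w', P.men m w w' ↔ a m w < a m w'
  women_iff : ∀ w m m', P.women w m m' ↔ b w m < b w m'

theorem exists_rank {α : Type*} [Finite α] (r : α → α → Prop) (hr : IsStrictTotalOrder α r) :
    ∃ f : α → ℕ, Injective f ∧ ∀ x y, r x y ↔ f x < f y := by
  have hmono : ∀ x y, r x y → Set.ncard {z | r z x} < Set.ncard {z | r z y} := by
    intro x y h
    refine Set.ncard_lt_ncard ⟨fun z hz => _root_.trans (r := r) hz h, fun hc => ?_⟩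
      (Set.toFinite _)
    exact irrefl_of r x (hc h)
  refine ⟨fun x => Set.ncard {z | r z x}, fun x y h => ?_, fun x y => ⟨hmono x y, fun h => ?_⟩⟩
  · rcases trichotomous_of r x y with h1 | h1 | h1
    · exact absurd h (hmono _ _ h1).ne
    · exact h1
    · exact absurd h (hmono _ _ h1).ne'
  · rcases trichotomous_of r x y with h1 | h1 | h1
    · exact h1
    · exact absurd h (by simp [h1])
    · exact absurd h (hmono _ _ h1).not_gt

theorem exists_isRanking [Finite M] [Finite W] (P : Profile M W) : ∃ a b, IsRanking P a b := by
  choose a ha ha' using fun m => exists_rank _ (P.men_order m)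
  choose b hb hb' using fun w => exists_rank _ (P.women_order w)
  exact ⟨a, b, ha, hb, ha', hb'⟩

theorem IsRanking.isStable_iff (h : IsRanking P a b) : IsStable P μ ↔ RankStable a b μ := by
  simp [IsStable, RankStable, h.men_iff, h.women_iff]

theorem IsFirst.unique (h : IsRanking P a b) {T : Set (M × W)} {m : M} {w w' : W}
    (hw : IsFirst P T m w) (hw' : IsFirst P T m w') : w = w' := by
  by_contra hne
  have h1 := (h.men_iff _ _ _).1 (hw.2 _ hw'.1 (Ne.symm hne))
  have h2 := (h.men_iff _ _ _).1 (hw'.2 _ hw.1 hne)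
  omega

theorem IsFirst.le (h : IsRanking P a b) {T : Set (M × W)} {m : M} {w w' : W}
    (hw : IsFirst P T m w) (hw' : (m, w') ∈ T) : a m w ≤ a m w' := by
  by_cases hne : w' = w
  · rw [hne]
  · exact ((h.men_iff _ _ _).1 (hw.2 _ hw' hne)).le

theorem exists_isFirst (h : IsRanking P a b) {T : Set (M × W)} {m : M} {w : W}
    (hw : (m, w) ∈ T) : ∃ w', IsFirst P T m w' := by
  obtain ⟨v, hv, hmin⟩ := (InvImage.wf (a m) wellFounded_lt).has_min {w | (m, w) ∈ T} ⟨w, hw⟩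
  refine ⟨v, hv, fun u hu hne => (h.men_iff _ _ _).2 (lt_of_le_of_ne ?_ ?_)⟩
  · exact not_lt.1 (show ¬ a m u < a m v from hmin u hu)
  · exact fun he => hne (h.men_injective m he).symm

/-- The table after `k` rounds of proposals. -/
abbrev proposalTable (P : Profile M W) (k : ℕ) : Set (M × W) := (proposalRound P)^[k] Set.univ

theorem proposalTable_succ (P : Profile M W) (k : ℕ) :
    proposalTable P (k + 1) = proposalRound P (proposalTable P k) :=
  Function.iterate_succ_apply' _ _ _

theorem proposalTable_succ_subset (P : Profile M W) (k : ℕ) :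
    proposalTable P (k + 1) ⊆ proposalTable P k := by
  rw [proposalTable_succ]
  exact fun p hp => hp.1

/-- A woman who has rejected a man holds a better proposal. -/
theorem exists_proposer_of_notMem [Finite M] (h : IsRanking P a b) (k : ℕ) {m : M} {w : W}
    (hmw : (m, w) ∉ proposalTable P k) :
    ∃ m', IsFirst P (proposalTable P k) m' w ∧ b w m' < b w m := by
  induction k generalizing m with
  | zero => exact absurd (Set.mem_univ _) hmw
  | succ k ih =>
    obtain ⟨m₁, hm₁, hlt⟩ : ∃ m', IsFirst P (proposalTable P k) m' w ∧ b w m' < b w m := by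
      by_cases hk : (m, w) ∈ proposalTable P k
      · rw [proposalTable_succ] at hmw
        by_contra! hc
        refine hmw ⟨hk, ?_⟩
        rintro ⟨-, m', hm', hw⟩
        exact absurd ((h.women_iff _ _ _).1 hw) (not_lt.2 (hc m' hm'))
      · exact ih hk
    -- The best current proposer is not rejected, so he proposes to `w` again in the next round.
    obtain ⟨m₂, hm₂, hmin⟩ := (InvImage.wf (b w) wellFounded_lt).has_min
      {m | IsFirst P (proposalTable P k) m w} ⟨m₁, hm₁⟩
    have hmin' : ∀ x, IsFirst P (proposalTable P k) x w → b w m₂ ≤ b w x := fun x hx =>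
      not_lt.1 (show ¬ b w x < b w m₂ from hmin x hx)
    refine ⟨m₂, ⟨?_, fun w' hw' => hm₂.2 w' (proposalTable_succ_subset P k hw')⟩,
      (hmin' _ hm₁).trans_lt hlt⟩
    rw [proposalTable_succ]
    refine ⟨hm₂.1, ?_⟩
    rintro ⟨-, m', hm', hw⟩
    exact absurd ((h.women_iff _ _ _).1 hw) (not_lt.2 (hmin' m' hm'))

theorem RankStable.mem_proposalTable (h : IsRanking P a b) (hν : RankStable a b ν) (k : ℕ)
    (m : M) : (m, ν m) ∈ proposalTable P k := by
  induction k generalizing m with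
  | zero => trivial
  | succ k ih =>
    rw [proposalTable_succ]
    refine ⟨ih m, ?_⟩
    rintro ⟨-, m', hm', hw⟩
    rw [h.women_iff] at hw
    have hle := hm'.le h (ih m')
    rcases hle.lt_or_eq with h1 | h1
    · have := hν _ _ h1
      rw [Equiv.symm_apply_apply] at this
      exact absurd this (not_le.2 hw)
    · rw [ν.injective (h.men_injective _ h1)] at hw
      exact lt_irrefl _ hw

/-- If all women had rejected `m`, each would hold a proposer other than `m`, and different women
different ones; as there are as many women as men, `m` would be among them. -/
theorem exists_mem_proposalTable [Fintype M] [Fintype W]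
    (hcard : Fintype.card M = Fintype.card W) (h : IsRanking P a b) (k : ℕ) (m : M) :
    ∃ w, (m, w) ∈ proposalTable P k := by
  classical
  by_contra! hc
  choose f hf hlt using fun w => exists_proposer_of_notMem h k (hc w)
  have hinj : Injective f := fun w w' he => (hf w).unique h (he ▸ hf w')
  obtain ⟨w, hw⟩ := ((Fintype.bijective_iff_injective_and_card f).2 ⟨hinj, hcard.symm⟩).2 m
  exact absurd (hlt w) (by simp [hw])

theorem exists_galeShapley_eq [Finite M] [Finite W] (P : Profile M W) :
    ∃ k, galeShapley P = proposalTable P k ∧ proposalRound P (proposalTable P k) =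
      proposalTable P k := by
  have hanti : Antitone (proposalTable P) := antitone_nat_of_succ_le (proposalTable_succ_subset P)
  obtain ⟨k, hk⟩ := WellFoundedGT.monotone_chain_condition
    (⟨fun k => OrderDual.toDual (proposalTable P k), hanti⟩ : ℕ →o (Set (M × W))ᵒᵈ)
  have hk' : ∀ n, k ≤ n → proposalTable P k = proposalTable P n := fun n hn => hk n hn
  refine ⟨k, ?_, ?_⟩
  · refine (Set.iInter_subset _ k).antisymm (Set.subset_iInter fun n => ?_)
    rcases le_total k n with h | h
    · exact (hk' n h).le
    · exact hanti h
  · rw [← proposalTable_succ, hk' (k + 1) (by omega)]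

/-- The table in which every woman has deleted the men below her partner in `ν`. -/
def stableTable (b : W → M → ℕ) (ν : M ≃ W) : Set (M × W) := {p | b p.2 p.1 ≤ b p.2 (ν.symm p.2)}

theorem RankStable.isFirst_stableTable (h : IsRanking P a b) (hν : RankStable a b ν) (m : M) :
    IsFirst P (stableTable b ν) m (ν m) := by
  refine ⟨by simp [stableTable], fun w hw hne => (h.men_iff _ _ _).2 ?_⟩
  by_contra! hc
  have hlt := lt_of_le_of_ne hc fun he => hne (h.men_injective _ he)
  have := h.women_injective _ (le_antisymm hw (hν _ _ hlt))
  exact hne ((Equiv.eq_symm_apply ν).1 this).symm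

/-- The Gale-Shapley algorithm produces the best stable matching for the men. -/
theorem exists_isInduced [Fintype M] [Fintype W]
    (hcard : Fintype.card M = Fintype.card W) (h : IsRanking P a b) :
    ∃ μ, IsInduced P μ ∧ RankStable a b μ ∧
      (∀ ν, RankStable a b ν → ∀ m, a m (μ m) ≤ a m (ν m)) ∧
      reducedTable P = stableTable b μ := by
  obtain ⟨k, hk, hfix⟩ := exists_galeShapley_eq P
  choose f hf using fun m => (exists_mem_proposalTable hcard h k m).elim fun w hw =>
    exists_isFirst h hw
  have hinj : Injective f := by
    intro m m' he
    by_contra hne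
    wlog hlt : b (f m) m < b (f m) m' generalizing m m'
    · refine this he.symm (Ne.symm hne) ?_
      rw [← he]
      exact lt_of_le_of_ne (not_lt.1 hlt) fun he => hne (h.women_injective _ he).symm
    have hm' := hf m'
    have : (m', f m') ∈ proposalRound P (proposalTable P k) := by rw [hfix]; exact hm'.1
    exact this.2 ⟨hm', m, he ▸ hf m, (h.women_iff _ _ _).2 (he ▸ hlt)⟩
  let μ : M ≃ W := Equiv.ofBijective f
    ((Fintype.bijective_iff_injective_and_card f).2 ⟨hinj, hcard⟩)
  have hμ : ∀ m, IsFirst P (proposalTable P k) m (μ m) := hf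
  have hpart : ∀ m w, IsFirst P (proposalTable P k) m w ↔ m = μ.symm w := fun m w => by
    rw [Equiv.eq_symm_apply]
    exact ⟨fun hw => (hμ m).unique h hw, fun hw => hw ▸ hμ m⟩
  have hrej : ∀ m w, (m, w) ∉ proposalTable P k → b w (μ.symm w) < b w m := fun m w hmw => by
    obtain ⟨m', hm', hlt⟩ := exists_proposer_of_notMem h k hmw
    rwa [← (hpart m' w).1 hm']
  refine ⟨μ, fun m => hk ▸ hμ m, fun m w hmw => ?_, fun ν hν m => ?_, ?_⟩
  · exact (hrej m w fun hc => absurd ((hμ m).le h hc) (by omega)).le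
  · exact (hμ m).le h (hν.mem_proposalTable h k m)
  · ext ⟨m, w⟩
    simp only [reducedTable, hk, hpart, stableTable, Set.mem_ofPred_eq, h.women_iff, not_lt,
      forall_eq]
    exact ⟨fun hp => hp.2, fun hp => ⟨by_contra fun hc => absurd (hrej m w hc) (by omega), hp⟩⟩

theorem IsInduced.unique (h : IsRanking P a b) (hμ : IsInduced P μ) (hν : IsInduced P ν) :
    μ = ν := by
  ext m
  exact (hμ m).unique h (hν m)

end

/-! ### Cyclic sequences of pairs versus permutations -/

section

theorem _root_.Cycle.chain_iff_next {α : Type*} [DecidableEq α] {r : α → α → Prop} {s : Cycle α}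
    (hs : s.Nodup) : s.Chain r ↔ ∀ x (hx : x ∈ s), r x (s.next hs x hx) := by
  induction s using Quotient.inductionOn with | _ l
  rcases l with - | ⟨y, l⟩
  · simp
  · change (y :: l).Nodup at hs
    change Cycle.Chain r ((y :: l : List α) : Cycle α) ↔
      ∀ x (hx : x ∈ y :: l), r x ((y :: l).next x hx)
    set l' := y :: l with hl'
    -- Indexing by positions reduces the chain condition to consecutive indices and the wrap-around
    -- from `l.length` to `0`; the default `y` of `getD` is never reached.
    have hmap : ((l' : List α) : Cycle α) =
        Cycle.map (fun i => l'.getD i y) ((List.range (l.length + 1) : List ℕ) : Cycle ℕ) := by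
      rw [Cycle.map_coe]
      congr 1
      refine List.ext_getElem (by simp [hl']) fun i h1 h2 => ?_
      rw [List.getElem_map, List.getElem_range, List.getD_eq_getElem _ _ h1]
    rw [hmap, Cycle.chain_map, Cycle.chain_range_succ]
    have hlen : l'.length = l.length + 1 := by simp [hl']
    have hnext : ∀ i (hi : i < l'.length), l'.next l'[i] (List.getElem_mem hi) =
        l'.getD ((i + 1) % (l.length + 1)) y := fun i hi => by
      rw [List.next_getElem l' hs i hi, List.getD_eq_getElem _ _
        (by rw [hlen]; exact Nat.mod_lt _ (by omega))]
      simp [hlen]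
    constructor
    · rintro ⟨h0, h1⟩ x hx
      obtain ⟨i, hi, rfl⟩ := List.getElem_of_mem hx
      rw [hnext i hi, ← List.getD_eq_getElem _ y hi]
      rcases (show i < l.length ∨ i = l.length by omega) with h | h
      · rw [Nat.mod_eq_of_lt (by omega)]
        exact h1 i h
      · subst h
        simpa using h0
    · intro h
      have key : ∀ i, i < l.length + 1 →
          r (l'.getD i y) (l'.getD ((i + 1) % (l.length + 1)) y) := fun i hi => by
        have hi' : i < l'.length := by omega
        rw [← hnext i hi', List.getD_eq_getElem _ y hi']
        exact h _ _
      refine ⟨by simpa using key l.length (by omega), fun i hi => ?_⟩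
      have := key i (by omega)
      rwa [Nat.mod_eq_of_lt (by omega)] at this

variable {M W : Type*} {a : M → W → ℕ} {b : W → M → ℕ} {μ ν : M ≃ W} {P : Profile M W}
  {σ τ : Perm M}

theorem RankStable.isFirst_iff (h : IsRanking P a b) (hν : RankStable a b ν) {m : M} {w : W} :
    IsFirst P (stableTable b ν) m w ↔ ν m = w :=
  ⟨fun hw => (hν.isFirst_stableTable h m).unique h hw, fun hw => hw ▸ hν.isFirst_stableTable h m⟩

theorem RankStable.isSecond_iff (h : IsRanking P a b) (hν : RankStable a b ν) {m : M} {w : W} :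
    IsSecond P (stableTable b ν) m w ↔ IsNext a b ν m (ν.symm w) := by
  have hmem : ∀ w, (m, w) ∈ stableTable b ν \ {(m, ν m)} ↔
      a m (ν m) < a m w ∧ b w m < b w (ν.symm w) := by
    intro w
    simp only [Set.mem_sdiff, Set.mem_singleton_iff, Prod.mk.injEq, true_and]
    constructor
    · rintro ⟨h1, h2⟩
      refine ⟨(h.men_iff _ _ _).1 ((hν.isFirst_stableTable h m).2 w h1 h2), lt_of_le_of_ne h1 ?_⟩
      exact fun he => h2 ((Equiv.eq_symm_apply ν).1 (h.women_injective _ he)).symm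
    · rintro ⟨h1, h2⟩
      exact ⟨h2.le, by rintro rfl; exact lt_irrefl _ h1⟩
  simp only [IsSecond, hν.isFirst_iff h, exists_eq_left', IsNext, Equiv.apply_symm_apply]
  simp only [IsFirst, hmem]
  refine and_congr_right fun _ => ⟨fun h1 w' h2 h3 => ?_, fun h1 w' h2 hne => ?_⟩
  · by_cases he : w' = w
    · rw [he]
    · exact ((h.men_iff _ _ _).1 (h1 w' ⟨h2, h3⟩ he)).le
  · exact (h.men_iff _ _ _).2 (lt_of_le_of_ne (h1 w' h2.1 h2.2) fun he =>
      hne (h.men_injective _ he).symm)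

section
variable [Fintype M]

open Classical in
/-- The cyclic sequence of pairs of the rotation of `ν` that is described by `σ`. -/
noncomputable def rotationCycle (ν : M ≃ W) (σ : Perm M) (hσ : σ.IsCycle) : Cycle (M × W) :=
  (σ.toCycle hσ).map fun m => (m, ν m)

theorem mem_rotationCycle {hσ : σ.IsCycle} {p : M × W} :
    p ∈ rotationCycle ν σ hσ ↔ σ p.1 ≠ p.1 ∧ ν p.1 = p.2 := by
  classical
  obtain ⟨m, w⟩ := p
  simp only [rotationCycle, Cycle.mem_map, Perm.mem_toCycle_iff_support, Prod.mk.injEq]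
  exact ⟨by rintro ⟨m, h, rfl, rfl⟩; exact ⟨h, rfl⟩, fun h => ⟨m, h.1, rfl, h.2⟩⟩

theorem _root_.Cycle.map_map_eq {α β γ : Type*} (f : α → β) (g : β → γ) (s : Cycle α) :
    (s.map f).map g = s.map (g ∘ f) := by
  induction s using Quotient.inductionOn
  simp

theorem _root_.Cycle.map_congr_of_mem {α β : Type*} {f g : α → β} {s : Cycle α}
    (h : ∀ x ∈ s, f x = g x) : s.map f = s.map g := by
  induction s using Quotient.inductionOn with | _ l
  change Cycle.map f (l : Cycle α) = Cycle.map g (l : Cycle α)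
  rw [Cycle.map_coe, Cycle.map_coe, List.map_congr_left h]

theorem _root_.Cycle.map_id_eq {α : Type*} (s : Cycle α) : s.map id = s := by
  induction s using Quotient.inductionOn
  simp

theorem _root_.Cycle.Nodup.map_on {α β : Type*} {f : α → β} {s : Cycle α} (hs : s.Nodup)
    (h : ∀ x ∈ s, ∀ y ∈ s, f x = f y → x = y) : (s.map f).Nodup := by
  induction s using Quotient.inductionOn with | _ l
  exact List.Nodup.map_on h hs

theorem rotationCycle_congr {hσ : σ.IsCycle} (h : ∀ m, σ m ≠ m → μ m = ν m) :
    rotationCycle μ σ hσ = rotationCycle ν σ hσ := by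
  classical
  refine Cycle.map_congr_of_mem fun m hm => ?_
  rw [h m ((Perm.mem_toCycle_iff_support σ hσ).1 hm)]

theorem rotationCycle_inj {hσ : σ.IsCycle} {hτ : τ.IsCycle}
    (h : rotationCycle μ σ hσ = rotationCycle ν τ hτ) : σ = τ ∧ ∀ m, σ m ≠ m → μ m = ν m := by
  classical
  constructor
  · have := congrArg (Cycle.map Prod.fst) h
    simp only [rotationCycle, Cycle.map_map_eq] at this
    change Cycle.map id _ = Cycle.map id _ at this
    rw [Cycle.map_id_eq, Cycle.map_id_eq] at this
    exact congrArg Subtype.val (Perm.isoCycle.injective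
      (a₁ := ⟨σ, hσ⟩) (a₂ := ⟨τ, hτ⟩) (Subtype.ext this))
  · intro m hm
    have : (m, μ m) ∈ rotationCycle μ σ hσ := mem_rotationCycle.2 ⟨hm, rfl⟩
    rw [h] at this
    exact (mem_rotationCycle.1 this).2.symm

/-- The women in an exposed rotation are determined by the men, since each is her man's partner in
`ν`; so only the cycle of men matters. It is nontrivial because no man is his own successor. -/
theorem RankStable.isExposed_iff (h : IsRanking P a b) (hν : RankStable a b ν)
    {R : Cycle (M × W)} : IsExposed P (stableTable b ν) R ↔
      ∃ (σ : Perm M) (hσ : IsRot a b ν σ), R = rotationCycle ν σ hσ.1 := by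
  classical
  simp only [IsExposed, hν.isFirst_iff h, hν.isSecond_iff h]
  constructor
  · rintro ⟨hne, hnd, hch⟩
    have hfst : ∀ p ∈ R, p = (p.1, ν p.1) := fun p hp => by
      rw [((Cycle.chain_iff_next hnd).1 hch p hp).1]
    set c := R.map Prod.fst with hc
    have hR : R = c.map fun m => (m, ν m) := by
      rw [hc, Cycle.map_map_eq]
      conv_lhs => rw [← Cycle.map_id_eq R]
      exact Cycle.map_congr_of_mem hfst
    have hcnd : c.Nodup := hnd.map_on fun p hp q hq he => by rw [hfst p hp, hfst q hq, he]
    rw [hR, Cycle.chain_map] at hch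
    have hnext : ∀ m (hm : m ∈ c), IsNext a b ν m (c.next hcnd m hm) := fun m hm => by
      simpa using ((Cycle.chain_iff_next hcnd).1 hch m hm).2.2
    have hnt : c.Nontrivial := by
      obtain ⟨m, hm⟩ : ∃ m, m ∈ c := by
        by_contra! hc0
        refine hne ?_
        rw [hR, Cycle.map_eq_nil]
        clear_value c
        induction c using Quotient.inductionOn with | _ l
        rw [List.eq_nil_iff_forall_not_mem.2 hc0]
        rfl
      exact ⟨m, _, (hnext m hm).ne, hm, Cycle.next_mem _ _ _ _⟩
    have hcyc := c.isCycle_formPerm hcnd hnt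
    have hto : (c.formPerm hcnd).toCycle hcyc = c :=
      congrArg Subtype.val (Perm.isoCycle.right_inv ⟨c, hcnd, hnt⟩)
    refine ⟨c.formPerm hcnd, ⟨hcyc, fun m hm => ?_⟩, ?_⟩
    · have hmc : m ∈ c := by
        by_contra hmc
        exact hm (c.formPerm_eq_self_of_notMem hcnd m hmc)
      rw [c.formPerm_apply_mem_eq_next hcnd m hmc]
      exact hnext m hmc
    · rw [rotationCycle, hR]
      congr 1
      convert hto.symm
  · rintro ⟨σ, hσ, rfl⟩
    refine ⟨?_, ?_, ?_⟩
    · intro he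
      obtain ⟨m, hm, -⟩ := hσ.1
      have : (m, ν m) ∈ rotationCycle ν σ hσ.1 := mem_rotationCycle.2 ⟨hm, rfl⟩
      rw [he] at this
      exact Cycle.notMem_nil _ this
    · exact (Perm.nodup_toCycle σ hσ.1).map_on fun m _ m' _ he => congrArg Prod.fst he
    · rw [rotationCycle, Cycle.chain_map, Cycle.chain_iff_next (Perm.nodup_toCycle σ hσ.1)]
      intro m hm
      rw [Perm.toCycle_next]
      have := hσ.2 m ((Perm.mem_toCycle_iff_support σ hσ.1).1 hm)
      simpa using this

theorem IsRot.eliminate_eq (h : IsRanking P a b) (hν : RankStable a b ν) (hσ : IsRot a b ν σ) :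
    eliminate P (stableTable b ν) (rotationCycle ν σ hσ.1) = stableTable b (σ.trans ν) := by
  ext ⟨m, w⟩
  simp only [eliminate, hν.isSecond_iff h, h.women_iff, not_lt, mem_rotationCycle,
    Set.mem_ofPred_eq]
  simp only [stableTable, Set.mem_ofPred_eq, Equiv.symm_trans_apply]
  set q := σ.symm (ν.symm w) with hq
  have hσq : σ q = ν.symm w := by simp [hq]
  constructor
  · rintro ⟨h1, h2⟩
    by_cases hs : σ q = q
    · rwa [← hs, hσq]
    · exact h2 (q, ν q) ⟨hs, rfl⟩ (hσq ▸ hσ.2 q hs)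
  · intro h1
    refine ⟨h1.trans (by simpa using hσ.symm_trans_le w), ?_⟩
    rintro ⟨x, y⟩ ⟨hx, -⟩ hn
    have : σ x = ν.symm w := (hσ.2 x hx).unique h.men_injective hn
    rwa [show x = q by rw [hq, ← this, Equiv.symm_apply_apply]]

end

end

/-! ### Elimination sequences and closed sets -/

section

variable {M W : Type*} {a : M → W → ℕ} {b : W → M → ℕ} {μ ν κ : M ≃ W} {P : Profile M W}
  {σ τ : Perm M}

theorem stableTable_inj (h : IsRanking P a b) (hμ : RankStable a b μ) (hν : RankStable a b ν)
    (he : stableTable b μ = stableTable b ν) : μ = ν := by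
  ext m
  exact (hμ.isFirst_stableTable h m).unique h (he ▸ hν.isFirst_stableTable h m)

/-- A stable matching is either beyond a rotation for all its men or for none. -/
theorem IsRot.lt_of_lt [Finite M] (h : IsRanking P a b) (hκ : RankStable a b κ)
    (hμ : RankStable a b μ) (hσ : IsRot a b κ σ) {x y : M} (hx : σ x ≠ x) (hy : σ y ≠ y)
    (hlt : a x (κ x) < a x (μ x)) : a y (κ y) < a y (μ y) := by
  obtain ⟨i, rfl⟩ := hσ.1.exists_pow_eq hx hy
  clear hy
  induction i with
  | zero => exact hlt
  | succ i ih =>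
    have hi : σ ((σ ^ i) x) ≠ (σ ^ i) x := by
      rw [← Perm.mul_apply, ← pow_succ', pow_succ, Perm.mul_apply]
      exact fun he => hx ((σ ^ i).injective he)
    rw [pow_succ', Perm.mul_apply]
    exact (hσ.2 _ hi).lt h.men_injective h.women_injective hκ hμ ih

theorem EliminatesTo.isClosedSet {𝓢 : Set (Cycle (M × W))} {T : Set (M × W)}
    (hT : EliminatesTo P 𝓢 T) : IsClosedSet P 𝓢 := by
  induction hT with
  | start => exact ⟨by simp, by simp⟩
  | @step 𝓢 T R hT hR ih =>
    refine ⟨?_, ?_⟩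
    · rintro R' (rfl | hR')
      · exact ⟨𝓢, T, hT, hR⟩
      · exact ih.1 R' hR'
    · rintro R' (rfl | hR') R₁ hR₁
      · exact Set.mem_insert_of_mem _ (hR₁.2.2 𝓢 T hT hR)
      · exact Set.mem_insert_of_mem _ (ih.2 R' hR' R₁ hR₁)

variable [Fintype M] [Fintype W]

theorem EliminatesTo.exists_rankStable (hcard : Fintype.card M = Fintype.card W)
    (h : IsRanking P a b) {𝓢 : Set (Cycle (M × W))} {T : Set (M × W)} (hT : EliminatesTo P 𝓢 T) :
    ∃ ν, RankStable a b ν ∧ T = stableTable b ν ∧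
      ∀ R ∈ 𝓢, ∀ p ∈ R, a p.1 p.2 < a p.1 (ν p.1) := by
  induction hT with
  | start =>
    obtain ⟨μ, -, hμ, -, hT⟩ := exists_isInduced hcard h
    exact ⟨μ, hμ, hT, by simp⟩
  | @step 𝓢 T R _ hR ih =>
    obtain ⟨ν, hν, rfl, hlt⟩ := ih
    obtain ⟨σ, hσ, rfl⟩ := (hν.isExposed_iff h).1 hR
    refine ⟨σ.trans ν, hσ.rankStable hν h.men_injective, hσ.eliminate_eq h hν, ?_⟩
    rintro R (rfl | hR') p hp
    · obtain ⟨h1, h2⟩ := mem_rotationCycle.1 hp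
      rw [← h2]
      exact (hσ.2 _ h1).1.1
    · exact (hlt R hR' p hp).trans_le (hσ.le_trans _)

/-- No elimination sequence can get past a rotation without eliminating it: the step that first
carries its men beyond their women must be that rotation. -/
theorem EliminatesTo.mem_of_lt (hcard : Fintype.card M = Fintype.card W)
    (h : IsRanking P a b) {𝓢 : Set (Cycle (M × W))} {T : Set (M × W)} (hT : EliminatesTo P 𝓢 T)
    (hν : RankStable a b ν) (hTν : T = stableTable b ν) (hκ : RankStable a b κ)
    (hσ : IsRot a b κ σ) (hlt : ∀ m, σ m ≠ m → a m (κ m) < a m (ν m)) :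
    rotationCycle κ σ hσ.1 ∈ 𝓢 := by
  have ha := h.men_injective
  have hb := h.women_injective
  obtain ⟨m₀, hm₀, -⟩ := id hσ.1
  induction hT generalizing ν with
  | start =>
    obtain ⟨μ, -, hμ, hopt, hT⟩ := exists_isInduced hcard h
    rw [hT] at hTν
    have := stableTable_inj h hμ hν hTν
    subst this
    exact absurd (hlt m₀ hm₀) (not_lt.2 (hopt κ hκ m₀))
  | @step 𝓢 T R hT hR ih =>
    obtain ⟨μ, hμ, rfl, -⟩ := hT.exists_rankStable hcard h
    obtain ⟨ρ, hρ, rfl⟩ := (hμ.isExposed_iff h).1 hR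
    rw [hρ.eliminate_eq h hμ] at hTν
    have := stableTable_inj h (hρ.rankStable hμ ha) hν hTν
    subst this
    by_cases hall : ∀ m, σ m ≠ m → a m (κ m) < a m (μ m)
    · exact Set.mem_insert_of_mem _ (ih hμ rfl hall)
    push Not at hall
    obtain ⟨m₁, hm₁, hle₁⟩ := hall
    have hle : ∀ m, σ m ≠ m → a m (μ m) ≤ a m (κ m) := fun m hm => by
      by_contra! hc
      exact absurd (hσ.lt_of_lt h hκ hμ hm hm₁ hc) (by omega)
    have hmove : ∀ m, σ m ≠ m → ρ m ≠ m := fun m hm he => by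
      have h1 := hle m hm
      have h2 := hlt m hm
      rw [Equiv.trans_apply, he] at h2
      omega
    -- If `m` were still strictly before `κ m`, one step of `ρ` could not carry him beyond it, as
    -- `κ` is stable.
    have heq : ∀ m, σ m ≠ m → κ m = μ m := fun m hm => by
      refine ha m (le_antisymm ?_ (hle m hm))
      by_contra! hc
      have h1 := (hρ.2 m (hmove m hm)).le ha hb hμ hκ hc
      have h2 := hlt m hm
      rw [Equiv.trans_apply] at h2
      omega
    have hσρ : ∀ m, σ m ≠ m → ρ m = σ m := fun m hm => by
      have h1 := (hσ.2 m hm).le ha hb hκ hν (hlt m hm)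
      have h2 := (hρ.2 m (hmove m hm)).le ha hb hμ (hσ.rankStable hκ ha)
        (heq m hm ▸ (hσ.2 m hm).1.1)
      rw [Equiv.trans_apply] at h1 h2
      have h3 := ha m (le_antisymm h2 h1)
      rw [heq (σ m) (by simpa using hm)] at h3
      exact μ.injective h3
    have hσμ : IsRot a b μ σ := ⟨hσ.1, fun m hm => hσρ m hm ▸ hρ.2 m (hmove m hm)⟩
    have := hσμ.eq_of_not_disjoint ha hρ hm₀ (hmove m₀ hm₀)
    subst this
    rw [rotationCycle_congr heq]
    exact Set.mem_insert _ _

/-- Every stable matching is reached by eliminating rotations. -/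
theorem RankStable.exists_eliminatesTo (hcard : Fintype.card M = Fintype.card W)
    (h : IsRanking P a b) (hν : RankStable a b ν) : ∃ 𝓢, EliminatesTo P 𝓢 (stableTable b ν) := by
  have ha := h.men_injective
  have hb := h.women_injective
  -- Here `n` bounds the total rank that the men still have to lose; each rotation costs at least
  -- one.
  have key : ∀ (n : ℕ) (κ : M ≃ W), RankStable a b κ → (∀ m, a m (κ m) ≤ a m (ν m)) →
      (∃ 𝓢, EliminatesTo P 𝓢 (stableTable b κ)) → ∑ m, a m (ν m) ≤ n + ∑ m, a m (κ m) →
      ∃ 𝓢, EliminatesTo P 𝓢 (stableTable b ν) := by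
    intro n
    induction n with
    | zero =>
      intro κ hκ hle hS hsum
      have hs : ∑ m, a m (κ m) = ∑ m, a m (ν m) :=
        le_antisymm (Finset.sum_le_sum fun m _ => hle m) (by omega)
      have := (Finset.sum_eq_sum_iff_of_le fun m _ => hle m).1 hs
      rwa [show ν = κ by ext m; exact ha m (this m (Finset.mem_univ _)).symm]
    | succ n ih =>
      intro κ hκ hle hS hsum
      by_cases hlt : ∃ m, a m (κ m) < a m (ν m)
      · obtain ⟨𝓢, hS⟩ := hS
        obtain ⟨σ, hσ, hσlt⟩ := exists_isRot ha hb hκ hν hlt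
        refine ih (σ.trans κ) (hσ.rankStable hκ ha) (fun m => ?_)
          ⟨insert (rotationCycle κ σ hσ.1) 𝓢, ?_⟩ ?_
        · by_cases hm : σ m = m
          · simpa [hm] using hle m
          · exact (hσ.2 m hm).le ha hb hκ hν (hσlt m hm)
        · rw [← hσ.eliminate_eq h hκ]
          exact hS.step ((hκ.isExposed_iff h).2 ⟨σ, hσ, rfl⟩)
        · obtain ⟨m₀, hm₀, -⟩ := hσ.1
          have : ∑ m, a m (κ m) < ∑ m, a m (σ.trans κ m) :=
            Finset.sum_lt_sum (fun m _ => hσ.le_trans m)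
              ⟨m₀, Finset.mem_univ _, (hσ.2 m₀ hm₀).1.1⟩
          omega
      · push Not at hlt
        rwa [show ν = κ by ext m; exact ha m (le_antisymm (hlt m) (hle m))]
  obtain ⟨μ, -, hμ, hopt, hT⟩ := exists_isInduced hcard h
  exact key _ μ hμ (hopt ν hν) ⟨∅, hT ▸ .start⟩ (Nat.le_add_right _ _)

/-- If only one rotation, `R`, can have been the last one that led to the stable matching `ν`, then
`ν` is the matching obtained by eliminating the smallest closed set that contains `R`. -/
theorem exists_eliminatesTo_cloSet (hcard : Fintype.card M = Fintype.card W)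
    (h : IsRanking P a b) (hν : RankStable a b ν) {τ : Perm W} (hτ : IsRot b a ν.symm τ)
    (huniq : ∀ τ', IsRot b a ν.symm τ' → τ' = τ) :
    ∃ R, EliminatesTo P (CloSet P {R}) (stableTable b ν) ∧
      ∀ 𝓢 μ, RankStable a b μ → EliminatesTo P 𝓢 (stableTable b μ) →
        (∀ m, a m (ν m) ≤ a m (μ m)) → R ∈ 𝓢 := by
  have ha := h.men_injective
  have hb := h.women_injective
  set κ : M ≃ W := (τ.trans ν.symm).symm
  have hκ : RankStable a b κ := (hτ.rankStable hν.swap hb).swap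
  set σ : Perm M := ν.symm.permCongr τ
  have hσ : IsRot a b κ σ := hτ.dual hν.swap hb
  have hκν : σ.trans κ = ν := permCongr_trans_symm (ν := ν.symm)
  obtain ⟨𝓢, hS⟩ := hκ.exists_eliminatesTo hcard h
  have hexp : IsExposed P (stableTable b κ) (rotationCycle κ σ hσ.1) :=
    (hκ.isExposed_iff h).2 ⟨σ, hσ, rfl⟩
  have hstep := hS.step hexp
  rw [hσ.eliminate_eq h hκ, hκν] at hstep
  refine ⟨rotationCycle κ σ hσ.1, ?_, fun 𝓣 μ hμ hT hle => ?_⟩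
  · convert hstep using 1
    refine Set.Subset.antisymm (Set.sInter_subset_of_mem ⟨hstep.isClosedSet, by simp⟩) ?_
    rintro R' hR' 𝓒 ⟨hC, hRC⟩
    rw [Set.singleton_subset_iff] at hRC
    rcases hR' with rfl | hR'
    · exact hRC
    refine hC.2 _ hRC R' ⟨hS.isClosedSet.1 R' hR', ⟨𝓢, _, hS, hexp⟩, fun 𝓢₁ T₁ hS₁ hexp₁ => ?_⟩
    obtain ⟨μ, hμ, rfl, hltμ⟩ := hS₁.exists_rankStable hcard h
    obtain ⟨σ₁, hσ₁, he⟩ := (hμ.isExposed_iff h).1 hexp₁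
    obtain ⟨hσσ, hκμ⟩ := rotationCycle_inj he
    subst hσσ
    have hμσ := hσ₁.rankStable hμ ha
    -- Otherwise some last rotation of `ν` has all its women strictly better off in `ν` than in
    -- `σ.trans μ`. It must be `τ`, but the women of `τ` have the same partners in both.
    have hle : ∀ m, a m (ν m) ≤ a m (σ.trans μ m) := by
      have := hν.swap.symm_le_of_le (μ := (σ.trans μ).symm) hb
      simp only [Equiv.symm_symm] at this
      refine this ?_
      by_contra! hc
      obtain ⟨τ', hτ', hτlt⟩ := exists_isRot hb ha hν.swap hμσ.swap (by simpa using hc)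
      have := huniq τ' hτ'
      subst this
      obtain ⟨w, hw, -⟩ := hτ.1
      have hw' : σ (ν.symm w) ≠ ν.symm w := by simpa [σ, Equiv.permCongr_apply] using hw
      have hw₁ : σ.trans μ (ν.symm w) = w := by
        rw [Equiv.trans_apply, ← hκμ _ (by simpa using hw'), ← Equiv.trans_apply, hκν,
          Equiv.apply_symm_apply]
      have := hτlt w hw
      rw [← (Equiv.eq_symm_apply _).2 hw₁] at this
      exact lt_irrefl _ this
    have hmem : R' ∈ insert (rotationCycle κ σ hσ.1) 𝓢₁ := by
      obtain ⟨𝓢₂, T₂, hS₂, hexp₂⟩ := hS.isClosedSet.1 R' hR'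
      obtain ⟨ι, hι, rfl, -⟩ := hS₂.exists_rankStable hcard h
      obtain ⟨ρ, hρ, rfl⟩ := (hι.isExposed_iff h).1 hexp₂
      obtain ⟨ν', hν', hTν', hlt'⟩ := hstep.exists_rankStable hcard h
      have := stableTable_inj h hν hν' hTν'
      subst this
      refine (hS₁.step hexp₁).mem_of_lt hcard h hμσ ?_ hι hρ fun m hm => ?_
      · rw [he, hσ₁.eliminate_eq h hμ]
      · exact (hlt' _ (Set.mem_insert_of_mem _ hR') (m, ι m)
          (mem_rotationCycle.2 ⟨hm, rfl⟩)).trans_le (hle m)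
    -- `R'` is not the rotation of `σ` itself: after eliminating `𝓢` the men of `σ` are still with
    -- their women in `κ`.
    rcases hmem with rfl | hmem
    · obtain ⟨κ', hκ', hTκ', hlt'⟩ := hS.exists_rankStable hcard h
      have := stableTable_inj h hκ hκ' hTκ'
      subst this
      obtain ⟨m, hm, -⟩ := hσ.1
      exact absurd (hlt' _ hR' (m, κ m) (mem_rotationCycle.2 ⟨hm, rfl⟩)) (lt_irrefl _)
    · exact hmem
  · refine hT.mem_of_lt hcard h hμ rfl hκ hσ fun m hm => ?_
    refine lt_of_lt_of_le ?_ (hle m)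
    rw [← hκν]
    exact (hσ.2 m hm).1.1

end

/-! ### Suitors, escapes and manipulations -/

section

variable {M W : Type*} {a : M → W → ℕ} {b : W → M → ℕ} {μ ν κ : M ≃ W} {P : Profile M W}
  {L : Set W}

/-- The man `s` prefers `w` to his partner in `ν`, and `w` can make him her second-best proposer:
she is a manipulator, or he is the best such man for her. -/
def IsSuitor (a : M → W → ℕ) (b : W → M → ℕ) (L : Set W) (ν : M ≃ W) (w : W) (s : M) : Prop :=
  a s w < a s (ν s) ∧ (w ∈ L ∨ ∀ t, a t w < a t (ν t) → b w s ≤ b w t)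

/-- In `n` steps, each from a woman to the partner of one of her suitors, one can get from `w` to a
woman without suitors, avoiding the set `A`. -/
inductive Escapes (a : M → W → ℕ) (b : W → M → ℕ) (L : Set W) (ν : M ≃ W) (A : Set W) :
    ℕ → W → Prop
  | sink {w : W} : w ∉ A → (∀ s, a s (ν s) ≤ a s w) → Escapes a b L ν A 0 w
  | step {w : W} {s : M} {n : ℕ} : w ∉ A → IsSuitor a b L ν w s → Escapes a b L ν A n (ν s) →
      Escapes a b L ν A (n + 1) w

theorem RankStable.lt_of_prefers (hb : ∀ w, Injective (b w)) (hν : RankStable a b ν) {w : W}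
    {s : M} (hs : a s w < a s (ν s)) : b w (ν.symm w) < b w s := by
  refine lt_of_le_of_ne (hν _ _ hs) fun he => ?_
  rw [← hb w he, Equiv.apply_symm_apply] at hs
  exact lt_irrefl _ hs

theorem IsNext.isSuitor (hb : ∀ w, Injective (b w)) (hν : RankStable a b ν) {w w' : W}
    (h : IsNext b a ν.symm w w') : IsSuitor a b L ν w (ν.symm w') :=
  ⟨by simpa using h.1.2, Or.inr fun s' hs' => h.2 s' (hν.lt_of_prefers hb hs') (by simpa using hs')⟩

theorem exists_isNext_symm (hb : ∀ w, Injective (b w)) (hν : RankStable a b ν) {w : W} {s : M}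
    (hs : a s w < a s (ν s)) : ∃ w', IsNext b a ν.symm w w' :=
  exists_isNext (w := s) (hν.lt_of_prefers hb hs) (by simpa using hs)

theorem isStrictTotalOrder_of_injective {α : Type*} {f : α → ℕ} (hf : Injective f) :
    IsStrictTotalOrder α fun x y => f x < f y :=
  (RelEmbedding.preimage ⟨f, hf⟩ (· < ·)).isStrictTotalOrder

/-- If some woman cannot escape, then this holds for all women of a rotation that can have been
the last one that led to `ν`. -/
theorem exists_isRot_of_not_escapes [Finite W] (hb : ∀ w, Injective (b w))
    (hν : RankStable a b ν) {w : W} (hw : ∀ n, ¬ Escapes a b L ν ∅ n w) :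
    ∃ τ, IsRot b a ν.symm τ ∧ ∀ w, τ w ≠ w → ∀ n, ¬ Escapes a b L ν ∅ n w := by
  refine exists_isRot_of_closed (B := {w | ∀ n, ¬ Escapes a b L ν ∅ n w}) ⟨w, hw⟩ fun x hx => ?_
  obtain ⟨s, hs⟩ : ∃ s, a s x < a s (ν s) := by
    by_contra! hc
    exact hx 0 (.sink (Set.notMem_empty _) hc)
  obtain ⟨y, hy⟩ := exists_isNext_symm hb hν hs
  refine ⟨y, fun n hn => hx (n + 1) (.step (Set.notMem_empty _) (hy.isSuitor hb hν) ?_), hy⟩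
  simpa using hn

theorem Escapes.mono_profile {a' : M → W → ℕ} {b' : W → M → ℕ} {A : Set W}
    (ha : ∀ m w w', a' m w < a' m w' ↔ a m w < a m w')
    (hb : ∀ w, w ∉ L → ∀ m m', b' w m < b' w m' ↔ b w m < b w m') {n : ℕ} {w : W}
    (h : Escapes a' b' ∅ ν A n w) : Escapes a b L ν A n w := by
  induction h with
  | sink hA hs => exact .sink hA fun s => by simpa [ha] using not_lt.2 (hs s)
  | @step w s n hA hs _ ih =>
    refine .step hA ⟨(ha _ _ _).1 hs.1, ?_⟩ ih
    by_cases hw : w ∈ L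
    · exact Or.inl hw
    · refine Or.inr fun s' hs' => ?_
      have := (hs.2.resolve_left (Set.notMem_empty _)) s' ((ha _ _ _).2 hs')
      rw [← not_lt] at this ⊢
      rwa [← hb w hw]

section
variable [Fintype M] [Fintype W]

/-- In the outcome of the algorithm every woman escapes. -/
theorem IsInduced.exists_escapes (hcard : Fintype.card M = Fintype.card W) (h : IsRanking P a b)
    (hν : IsInduced P ν) (w : W) : ∃ n, Escapes a b L ν ∅ n w := by
  obtain ⟨μ, hμ, hst, hopt, -⟩ := exists_isInduced hcard h
  have := hν.unique h hμ
  subst this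
  by_contra! hc
  obtain ⟨τ, hτ, -⟩ := exists_isRot_of_not_escapes h.women_injective hst hc
  obtain ⟨w, hw, -⟩ := id hτ.1
  have h1 := (hτ.2 w hw).1.2
  -- Undoing `τ` would give a stable matching that is better for this man than the men-optimal one.
  have h2 := hopt _ (hτ.rankStable hst.swap h.women_injective).swap (ν.symm (τ w))
  simp at h1 h2
  omega

theorem exists_escapes_of_mem_feasibleMatchings (hcard : Fintype.card M = Fintype.card W)
    (h : IsRanking P a b) (hν : ν ∈ feasibleMatchings P L) (w : W) :
    ∃ n, Escapes a b L ν ∅ n w := by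
  obtain ⟨-, P', ⟨hmen, hwomen⟩, hind⟩ := hν
  obtain ⟨a', b', h'⟩ := exists_isRanking P'
  obtain ⟨n, hn⟩ := hind.exists_escapes (L := ∅) hcard h' w
  refine ⟨n, hn.mono_profile (fun m w w' => ?_) fun w hw m m' => ?_⟩
  · rw [← h'.men_iff, ← h.men_iff, hmen]
  · rw [← h'.women_iff, ← h.women_iff, hwomen w hw]

/-- Each manipulator ranks her partner first and a suitor one step closer to an exit second. Any
further improvement for the men would need a cycle of women, each passing to the partner of her
chosen suitor, but the distance to an exit drops along every such edge. -/
theorem mem_feasibleMatchings_of_escapes (hcard : Fintype.card M = Fintype.card W)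
    (h : IsRanking P a b) (hν : RankStable a b ν) (hesc : ∀ w, ∃ n, Escapes a b L ν ∅ n w) :
    ν ∈ feasibleMatchings P L := by
  classical
  have ha := h.men_injective
  have hb := h.women_injective
  have hstep : ∀ w, ∃ s, (∃ s', a s' w < a s' (ν s')) →
      IsSuitor a b L ν w s ∧ Nat.find (hesc (ν s)) < Nat.find (hesc w) := by
    intro w
    have hn := Nat.find_spec (hesc w)
    generalize Nat.find (hesc w) = n at hn
    cases hn with
    -- A woman without suitors needs no choice; her partner is a dummy value.
    | sink _ hs => exact ⟨ν.symm w, fun ⟨s', hs'⟩ => absurd hs' (not_lt.2 (hs s'))⟩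
    | @step _ s n _ hs hn =>
      exact ⟨s, fun _ => ⟨hs, Nat.lt_succ_of_le (Nat.find_min' (hesc (ν s)) hn)⟩⟩
  choose s hs using hstep
  let b' : W → M → ℕ := fun w m =>
    if w ∈ L then (if m = ν.symm w then 0 else if m = s w then 1 else b w m + 2) else b w m
  have hb' : ∀ w, Injective (b' w) := by
    intro w m m' he
    simp only [b'] at he
    split_ifs at he <;> first | omega | simp_all
    all_goals exact hb w (by omega)
  let P' : Profile M W :=
    { men := P.men
      women := fun w m m' => b' w m < b' w m'
      men_order := P.men_order
      women_order := fun w => isStrictTotalOrder_of_injective (hb' w) }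
  have h' : IsRanking P' a b' := ⟨ha, hb', h.men_iff, fun _ _ _ => Iff.rfl⟩
  have hmanip : IsPermutationManipulation P L P' := by
    refine ⟨rfl, fun w hw => ?_⟩
    ext m m'
    simp [P', b', hw, h.women_iff]
  have hst : RankStable a b' ν := by
    intro m w hmw
    by_cases hw : w ∈ L
    · simp [b', hw]
    · simpa [b', hw] using hν m w hmw
  refine ⟨h.isStable_iff.2 hν, P', hmanip, ?_⟩
  obtain ⟨μ, hμ, hμst, hopt, -⟩ := exists_isInduced hcard h'
  suffices hμν : μ = ν by rwa [← hμν]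
  by_contra hne
  obtain ⟨m, hm⟩ : ∃ m, μ m ≠ ν m := by
    by_contra! hc
    exact hne (Equiv.ext hc)
  have hlt := lt_of_le_of_ne (hopt ν hst m) fun he => hm (ha m he)
  obtain ⟨τ, hτ, -⟩ := exists_isRot hb' ha hst.swap hμst.swap
    ⟨ν m, by simpa using hst.lt_of_lt ha hb' hμst hlt⟩
  obtain ⟨w₀, hw₀, -⟩ := id hτ.1
  obtain ⟨w, hw, hmin⟩ := (InvImage.wf (fun w => Nat.find (hesc w)) wellFounded_lt).has_min
    {w | τ w ≠ w} ⟨w₀, hw₀⟩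
  have hnext := hτ.2 w hw
  have hsuit := hnext.isSuitor (L := ∅) hb' hst
  obtain ⟨hsw, hlt⟩ := hs w ⟨_, hsuit.1⟩
  refine hmin (ν (s w)) ?_ hlt
  -- The rotation follows favourites in the reported lists. For a manipulator that is `s w`, at rank
  -- 1 behind her partner; for any other woman `s w` is her true favourite.
  suffices he : ν.symm (τ w) = s w by
    rw [← he, Equiv.apply_symm_apply]
    exact fun hc => hw (τ.injective hc)
  have h1 := (hsuit.2.resolve_left (Set.notMem_empty _)) (s w) hsw.1
  have h2 : b' w (ν.symm w) < b' w (ν.symm (τ w)) := hnext.1.1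
  have h3 : s w ≠ ν.symm w := fun hc => by
    have := hsw.1
    simp [hc] at this
  by_cases hL : w ∈ L
  · refine hb' w (le_antisymm h1 ?_)
    have h4 : b' w (s w) = 1 := by simp [b', hL, h3]
    omega
  · have h4 := hsw.2.resolve_left hL _ hsuit.1
    simp only [b', hL, if_false] at h1
    exact hb w (le_antisymm h1 h4)

end

/-- The women on the rotations that can have been the last one that led to `ν`. -/
def lastWomen (a : M → W → ℕ) (b : W → M → ℕ) (ν : M ≃ W) : Set W :=
  {w | ∃ τ, IsRot b a ν.symm τ ∧ τ w ≠ w}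

/-- An escape from a last rotation leads to an escape that does not return to any of them. -/
theorem Escapes.exists_avoiding {n : ℕ} {w : W} (h : Escapes a b L ν ∅ n w) :
    (∃ n, Escapes a b L ν (lastWomen a b ν) n w) ∨ ∃ w' ∈ lastWomen a b ν,
      (∀ s, a s (ν s) ≤ a s w') ∨
      ∃ s n, IsSuitor a b L ν w' s ∧ Escapes a b L ν (lastWomen a b ν) n (ν s) := by
  induction h with
  | @sink w _ hs =>
    by_cases hw : w ∈ lastWomen a b ν
    · exact Or.inr ⟨w, hw, Or.inl hs⟩
    · exact Or.inl ⟨0, .sink hw hs⟩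
  | @step w s n _ hs _ ih =>
    rcases ih with ⟨n, hn⟩ | ih
    · by_cases hw : w ∈ lastWomen a b ν
      · exact Or.inr ⟨w, hw, Or.inr ⟨s, n, hs, hn⟩⟩
      · exact Or.inl ⟨n + 1, .step hw hs hn⟩
    · exact Or.inr ih

/-- Undoing a rotation improves the men, so `w` attracts no new men, and `s` stays her favourite if
he was; he keeps his partner because `τ` fixes her. -/
theorem IsSuitor.undo {τ : Perm W} (hτ : IsRot b a ν.symm τ) {w : W} {s : M}
    (hs : IsSuitor a b L ν w s) (hfix : τ (ν s) = ν s) :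
    IsSuitor a b L (τ.trans ν.symm).symm w s ∧ (τ.trans ν.symm).symm s = ν s := by
  have he : (τ.trans ν.symm).symm s = ν s := by
    rw [Equiv.symm_apply_eq, Equiv.trans_apply, hfix, Equiv.symm_apply_apply]
  refine ⟨⟨by rw [he]; exact hs.1, hs.2.imp_right fun h s' hs' => h s' (hs'.trans_le ?_)⟩, he⟩
  simpa using hτ.symm_trans_le s'

theorem Escapes.undo {τ : Perm W} (hτ : IsRot b a ν.symm τ) {n : ℕ} {w : W}
    (h : Escapes a b L ν (lastWomen a b ν) n w) :
    Escapes a b L (τ.trans ν.symm).symm ∅ n w ∧ τ w = w := by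
  have hfix : ∀ w ∉ lastWomen a b ν, τ w = w := fun w hw => by
    by_contra hc
    exact hw ⟨τ, hτ, hc⟩
  induction h with
  | @sink w hw hs =>
    refine ⟨.sink (Set.notMem_empty _) fun s => le_trans ?_ (hs s), hfix w hw⟩
    simpa using hτ.symm_trans_le s
  | @step w s n hw hs _ ih =>
    obtain ⟨h1, h2⟩ := hs.undo hτ ih.2
    exact ⟨.step (Set.notMem_empty _) h1 (h2 ▸ ih.1), hfix w hw⟩

/-- Undo last rotations, one after another, until only one is left. -/
theorem exists_unique_last [Fintype M] [Finite W]
    (hb : ∀ w, Injective (b w)) (hν : RankStable a b ν)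
    (h : ∃ w ∈ lastWomen a b ν, ∃ n, Escapes a b L ν ∅ n w) :
    ∃ κ, RankStable a b κ ∧ (∀ m, a m (κ m) ≤ a m (ν m)) ∧
      (∃ τ, IsRot b a κ.symm τ ∧ ∀ τ', IsRot b a κ.symm τ' → τ' = τ) ∧
      ∀ w, ∃ n, Escapes a b L κ ∅ n w := by
  induction hN : ∑ m, a m (ν m) using Nat.strong_induction_on generalizing ν with | _ N ih
  obtain ⟨w, hw, n, hn⟩ := h
  -- With one last rotation, a trapped woman would trap all its women, including the escaping `w`.
  by_cases huniq : ∃ τ, IsRot b a ν.symm τ ∧ ∀ τ', IsRot b a ν.symm τ' → τ' = τ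
  · refine ⟨ν, hν, fun m => le_rfl, huniq, fun x => ?_⟩
    by_contra! hx
    obtain ⟨τ, hτ, hτx⟩ := exists_isRot_of_not_escapes hb hν hx
    obtain ⟨τ', hτ', hτw⟩ := hw
    obtain ⟨τ₀, -, hall⟩ := huniq
    rw [hall τ' hτ', ← hall τ hτ] at hτw
    exact hτx w hτw n hn
  push Not at huniq
  obtain ⟨w, ⟨τ, hτ, hτw⟩, hw⟩ : ∃ w' ∈ lastWomen a b ν, (∀ s, a s (ν s) ≤ a s w') ∨
      ∃ s n, IsSuitor a b L ν w' s ∧ Escapes a b L ν (lastWomen a b ν) n (ν s) := by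
    rcases hn.exists_avoiding with ⟨n, hn⟩ | h
    · cases hn with
      | sink hA _ => exact absurd hw hA
      | step hA _ _ => exact absurd hw hA
    · exact h
  obtain ⟨τ', hτ', hne⟩ := huniq τ hτ
  have hle : ∀ m, a m ((τ'.trans ν.symm).symm m) ≤ a m (ν m) := fun m => by
    simpa using hτ'.symm_trans_le m
  have hsum : ∑ m, a m ((τ'.trans ν.symm).symm m) < N := by
    rw [← hN]
    obtain ⟨w, hw, -⟩ := hτ'.1
    refine Finset.sum_lt_sum (fun m _ => hle m) ⟨ν.symm (τ' w), Finset.mem_univ _, ?_⟩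
    simpa using (hτ'.2 w hw).1.2
  have hesc : ∃ w ∈ lastWomen a b (τ'.trans ν.symm).symm,
      ∃ n, Escapes a b L (τ'.trans ν.symm).symm ∅ n w := by
    refine ⟨w, ⟨τ, hτ.persist hb hτ' hne.symm, hτw⟩, ?_⟩
    rcases hw with hw | ⟨s, n, hs, hn⟩
    · exact ⟨0, .sink (Set.notMem_empty _) fun s => (hle s).trans (hw s)⟩
    · obtain ⟨h1, h2⟩ := hn.undo hτ'
      obtain ⟨h3, h4⟩ := hs.undo hτ' h2
      exact ⟨n + 1, .step (Set.notMem_empty _) h3 (h4 ▸ h1)⟩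
  obtain ⟨κ, hκ, hκle, h⟩ := ih _ hsum (hτ'.rankStable hν.swap hb).swap hesc rfl
  exact ⟨κ, hκ, fun m => (hκle m).trans (hle m), h⟩

end

end StableMarriage

theorem mainTheorem7 {M W : Type*} [Fintype M] [Fintype W]
    (hcard : Fintype.card M = Fintype.card W)
    (P : StableMarriage.Profile M W) (L : Set W)
    (𝓡 : Set (Cycle (M × W))) (hclosed : StableMarriage.IsClosedSet P 𝓡) (hne : 𝓡.Nonempty)
    (helim : StableMarriage.CanBeEliminated P L 𝓡) :
    ∃ R ∈ 𝓡, StableMarriage.CanBeEliminated P L (StableMarriage.CloSet P {R}) := by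
  open StableMarriage in
  obtain ⟨a, b, h⟩ := exists_isRanking P
  have ha := h.men_injective
  have hb := h.women_injective
  obtain ⟨T, μ, hT, hfirst, hμ⟩ := helim
  obtain ⟨ν, hν, rfl, hlt⟩ := hT.exists_rankStable hcard h
  have : ν = μ := Equiv.ext fun m => (hν.isFirst_iff h).1 (hfirst m)
  subst this
  -- A member of `𝓡` has been eliminated, so `ν` is not optimal for the men and some rotation can be
  -- undone.
  have hlast : ∃ w, w ∈ lastWomen a b ν := by
    obtain ⟨R, hR⟩ := hne
    obtain ⟨𝓢, T', hT', hexp⟩ := hclosed.1 R hR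
    obtain ⟨κ, hκ, rfl, -⟩ := hT'.exists_rankStable hcard h
    obtain ⟨σ, hσ, rfl⟩ := (hκ.isExposed_iff h).1 hexp
    obtain ⟨m, hm, -⟩ := id hσ.1
    have hm' := hlt _ hR (m, κ m) (mem_rotationCycle.2 ⟨hm, rfl⟩)
    obtain ⟨τ, hτ, -⟩ := exists_isRot hb ha hν.swap hκ.swap
      ⟨ν m, by simpa using hν.lt_of_lt ha hb hκ hm'⟩
    obtain ⟨w, hw, -⟩ := id hτ.1
    exact ⟨w, τ, hτ, hw⟩
  obtain ⟨w, hw⟩ := hlast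
  obtain ⟨κ, hκ, hle, ⟨τ, hτ, huniq⟩, hesc⟩ := exists_unique_last (L := L) hb hν
    ⟨w, hw, exists_escapes_of_mem_feasibleMatchings hcard h hμ w⟩
  obtain ⟨R, hR, hmem⟩ := exists_eliminatesTo_cloSet hcard h hκ hτ huniq
  exact ⟨R, hmem 𝓡 ν hν hT hle, _, κ, hR, hκ.isFirst_stableTable h,
    mem_feasibleMatchings_of_escapes hcard h hκ hesc⟩
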